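/- Theorem 1. All graphs are finite and simple. A graph $H$ is a minor of a graph $G$ if $H$ can be obtained by contracting edges of a subgraph of $G$. The spectral radius $\mu(G)$ is the largest eigenvalue of the adjacency matrix of $G$. Let $n>40000$, write $n-1=3p+s$ with integers $p\ge 0$ and $s\in\{0,1,2\}$, and let $F_3(n)=K_1\vee(pK_3+K_s)$, that is, the graph obtained from the disjoint union of $p$ triangles and a complete graph $K_s$ (absent if $s=0$) by adding one new vertex joined to all the other vertices. Then $F_3(n)$ is a graph of order $n$ with no $K_{2,3}$ minor, and every graph $G$ of order $n$ with no $K_{2,3}$ minor satisfies $\mu(G)<\mu(F_3(n))$, unless $G$ is isomorphic to $F_3(n)$. -/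

import Mathlib

namespace SpectralMinor

/-- `H` is a minor of `G`: there are pairwise disjoint, connected (in particular nonempty)
sets of vertices `B w` of `G`, one for each vertex `w` of `H`, such that `G` has an edge between
`B u` and `B v` whenever `u` and `v` are adjacent in `H`. Contracting each `B w` to a vertex, in
the subgraph of `G` formed by the sets `B w`, their edges, and the edges of `G` that join `B u`
and `B v` for adjacent `u` and `v`, gives `H`. -/
def IsMinor {W V : Type*} (H : SimpleGraph W) (G : SimpleGraph V) : Prop :=
  ∃ B : W → Set V,
    (∀ w, (G.induce (B w)).Connected) ∧
    (∀ u v, u ≠ v → Disjoint (B u) (B v)) ∧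
    (∀ u v, H.Adj u v → ∃ x ∈ B u, ∃ y ∈ B v, G.Adj x y)

open Classical in
/-- The spectral radius of a finite graph: the largest eigenvalue of its adjacency matrix
(for a nonempty vertex set, the set below is finite and nonempty). -/
noncomputable def specRadius {V : Type*} [Fintype V] (G : SimpleGraph V) : ℝ :=
  sSup {x : ℝ | Module.End.HasEigenvalue (Matrix.toLin' (G.adjMatrix ℝ)) x}

/-- The join `G ∨ H`: the disjoint union, with all edges between the two parts added. -/
def join {V W : Type*} (G : SimpleGraph V) (H : SimpleGraph W) : SimpleGraph (V ⊕ W) :=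
  G.sum H ⊔ completeBipartiteGraph V W

/-- The disjoint union `pG` of `p` copies of `G`. -/
def copies {V : Type*} (p : ℕ) (G : SimpleGraph V) : SimpleGraph (Fin p × V) where
  Adj x y := x.1 = y.1 ∧ G.Adj x.2 y.2
  symm := ⟨fun _ _ h => ⟨h.1.symm, h.2.symm⟩⟩
  loopless := ⟨fun _ h => h.2.ne rfl⟩

/-- The graph `F_t(n) = K_1 ∨ (p K_t + K_s)`, where `n - 1 = p t + s` and `0 ≤ s < t`. -/
def extremalGraph (t n : ℕ) :
    SimpleGraph (Fin 1 ⊕ (Fin ((n - 1) / t) × Fin t ⊕ Fin ((n - 1) % t))) :=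
  join (⊤ : SimpleGraph (Fin 1))
    ((copies ((n - 1) / t) (⊤ : SimpleGraph (Fin t))).sum
      (⊤ : SimpleGraph (Fin ((n - 1) % t))))

end SpectralMinor

/-!
Let `G` have order `n` and no `K_{2,3}` minor, let `μ` be its spectral radius, and suppose that
`μ` is at least the spectral radius of the extremal graph. Then `G` is the extremal graph, for the
following reasons.

* A test vector on the extremal graph shows that `μ ^ 2 - 2 * μ` is at least
  `n - 1 - 2 / (μ - 1)` (`le_of_specRadius_extremalGraph_le`), so that `μ` is at least of order
  `√n`.
* `G` has at most `4 * n` edges, as breadth-first search shows (`sum_degree_le`), and two vertices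
  of `G` have at most two common neighbours. If `x` is a nonnegative eigenvector with largest entry
  `x w = 1`, then the entries of `x` have sum at most `8 * μ`, and the equation for `μ ^ 2 * x u`
  forces `w` to be adjacent to almost all vertices and every other entry to be small. The equation
  for `μ ^ 2 * x w` then shows that `w` is adjacent to all other vertices (`adj_of_isMax`).
* Hence all degrees in `G - w` are at most two, and `n - 1 + 2 * μ - μ ^ 2` is the sum of
  `(2 - deg v) * x v` over `G - w`, with `deg` the degree in `G - w`. By the bound on `μ`, this sum
  is at most `2 / (μ - 1)`. Since each entry is at least `1 / μ`, the total deficiency, an even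
  number, is `0` or `2`, and the vertices of deficient degree can only be a `K_1` or a `K_2`
  component (`nonempty_iso_of_dominating`). The other components of `G - w` are cycles, and a
  cycle longer than a triangle would give a `K_{2,3}` minor together with `w`
  (`adj_of_mem_neighborsOff`).

The extremal graph itself has no `K_{2,3}` minor, because its blocks have at most four vertices and
`K_{2,3}` is `2`-connected (`not_isMinor_extremalGraph`).
-/

namespace SpectralMinor

open Finset

/-! ### The spectral radius as the maximum of the quadratic form -/

/-- The quadratic form of a real matrix attains its maximum over the unit sphere. -/
theorem exists_max_quadraticForm {V : Type*} [Fintype V] [Nonempty V] (A : Matrix V V ℝ) :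
    ∃ z : V → ℝ, z ⬝ᵥ z = 1 ∧
      ∀ y : V → ℝ, y ⬝ᵥ A.mulVec y ≤ (z ⬝ᵥ A.mulVec z) * (y ⬝ᵥ y) := by
  classical
  have hcl : IsClosed {z : V → ℝ | z ⬝ᵥ z = 1} := by
    refine isClosed_eq ?_ continuous_const
    simp only [dotProduct]
    fun_prop
  have hbd : Bornology.IsBounded {z : V → ℝ | z ⬝ᵥ z = 1} := by
    refine (Metric.isBounded_closedBall (x := (0 : V → ℝ)) (r := 1)).subset fun z hz => ?_
    rw [mem_closedBall_zero_iff, pi_norm_le_iff_of_nonneg zero_le_one]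
    intro v
    have h1 : z v * z v ≤ z ⬝ᵥ z :=
      Finset.single_le_sum (f := fun u => z u * z u) (fun u _ => mul_self_nonneg _) (mem_univ v)
    rw [Set.mem_ofPred_eq] at hz
    rw [Real.norm_eq_abs, abs_le]
    constructor <;> nlinarith
  have hne : {z : V → ℝ | z ⬝ᵥ z = 1}.Nonempty := by
    obtain ⟨v⟩ := ‹Nonempty V›
    exact ⟨Pi.single v 1, by simp⟩
  have hco : ContinuousOn (fun z : V → ℝ => z ⬝ᵥ A.mulVec z) {z : V → ℝ | z ⬝ᵥ z = 1} := by
    apply Continuous.continuousOn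
    simp only [dotProduct, Matrix.mulVec]
    fun_prop
  obtain ⟨z, hz, hmax⟩ :=
    (Metric.isCompact_of_isClosed_isBounded hcl hbd).exists_isMaxOn hne hco
  refine ⟨z, hz, fun y => ?_⟩
  rcases eq_or_ne y 0 with rfl | hy
  · simp
  have hpos : 0 < y ⬝ᵥ y := by
    refine lt_of_le_of_ne (Finset.sum_nonneg fun v _ => mul_self_nonneg _) fun h => hy ?_
    exact dotProduct_self_eq_zero.1 h.symm
  set r := Real.sqrt (y ⬝ᵥ y) with hr
  have hrr : r * r = y ⬝ᵥ y := Real.mul_self_sqrt hpos.le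
  have hr0 : r ≠ 0 := (Real.sqrt_pos.2 hpos).ne'
  have hmem : r⁻¹ • y ∈ {z : V → ℝ | z ⬝ᵥ z = 1} := by
    simp only [Set.mem_ofPred_eq, smul_dotProduct, dotProduct_smul, smul_eq_mul, ← hrr]
    field_simp
  have h := hmax hmem
  simp only [Set.mem_ofPred_eq, Matrix.mulVec_smul, smul_dotProduct, dotProduct_smul,
    smul_eq_mul] at h
  rw [← hrr]
  calc y ⬝ᵥ A.mulVec y = (r⁻¹ * (r⁻¹ * y ⬝ᵥ A.mulVec y)) * (r * r) := by field_simp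
    _ ≤ _ := by gcongr

/-- The largest eigenvalue of a symmetric matrix with nonnegative entries bounds its quadratic
form and has a nonnegative eigenvector: the form does not decrease when a maximizer is replaced
by its entrywise absolute value. -/
theorem exists_nonneg_eigenvector_matrix {V : Type*} [Fintype V] [DecidableEq V] [Nonempty V]
    (A : Matrix V V ℝ) (hA : A.IsSymm) (h0 : ∀ i j, 0 ≤ A i j) :
    ∃ M : ℝ, IsGreatest {x : ℝ | Module.End.HasEigenvalue (Matrix.toLin' A) x} M ∧
      (∀ y : V → ℝ, y ⬝ᵥ A.mulVec y ≤ M * (y ⬝ᵥ y)) ∧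
      ∃ x : V → ℝ, (∀ v, 0 ≤ x v) ∧ x ≠ 0 ∧ A.mulVec x = M • x := by
  obtain ⟨z, hz, hmax⟩ := exists_max_quadraticForm A
  set M := z ⬝ᵥ A.mulVec z with hM
  set x : V → ℝ := fun v => |z v| with hx
  have hxx : x ⬝ᵥ x = 1 := by rw [← hz]; simp [dotProduct, hx]
  have hge : M ≤ x ⬝ᵥ A.mulVec x := by
    simp only [hM, dotProduct, Matrix.mulVec, Finset.mul_sum]
    refine Finset.sum_le_sum fun i _ => Finset.sum_le_sum fun j _ => ?_
    calc z i * (A i j * z j) ≤ |z i * (A i j * z j)| := le_abs_self _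
      _ = _ := by rw [abs_mul, abs_mul, abs_of_nonneg (h0 i j)]
  have hpsd : (M • (1 : Matrix V V ℝ) - A).PosSemidef := by
    refine Matrix.PosSemidef.of_dotProduct_mulVec_nonneg ?_ fun y => ?_
    · rw [Matrix.IsHermitian, Matrix.conjTranspose_eq_transpose_of_trivial]
      simp [hA.eq]
    · have := hmax y
      simp only [star_trivial, Matrix.sub_mulVec, Matrix.smul_mulVec, Matrix.one_mulVec,
        dotProduct_sub, dotProduct_smul, smul_eq_mul]
      linarith
  have hev : A.mulVec x = M • x := by
    have h := (hpsd.dotProduct_mulVec_zero_iff x).1 (by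
      have h1 := hmax x
      rw [hxx] at h1
      simp only [star_trivial, Matrix.sub_mulVec, Matrix.smul_mulVec, Matrix.one_mulVec,
        dotProduct_sub, dotProduct_smul, smul_eq_mul, hxx]
      linarith)
    rw [Matrix.sub_mulVec, Matrix.smul_mulVec, Matrix.one_mulVec] at h
    exact (sub_eq_zero.1 h).symm
  have hx0 : x ≠ 0 := by
    rintro h
    simp [h] at hxx
  refine ⟨M, ⟨?_, ?_⟩, hmax, x, fun v => abs_nonneg _, hx0, hev⟩
  · exact Module.End.hasEigenvalue_of_hasEigenvector
      (Module.End.hasEigenvector_iff.2 ⟨by simpa [Module.End.mem_eigenspace_iff] using hev, hx0⟩)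
  · intro t ht
    obtain ⟨y, hy⟩ := ht.exists_hasEigenvector
    have h1 := hy.apply_eq_smul
    rw [Matrix.toLin'_apply] at h1
    have h2 := hmax y
    rw [h1, dotProduct_smul, smul_eq_mul] at h2
    have hpos : 0 < y ⬝ᵥ y := by
      refine lt_of_le_of_ne (Finset.sum_nonneg fun v _ => mul_self_nonneg _) fun h => hy.2 ?_
      exact dotProduct_self_eq_zero.1 h.symm
    exact le_of_mul_le_mul_right h2 hpos

/-- The spectral radius bounds the quadratic form of the adjacency matrix and has a nonnegative
eigenvector. -/
theorem specRadius_spec {V : Type*} [Fintype V] [Nonempty V] (G : SimpleGraph V)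
    [DecidableRel G.Adj] :
    (∀ y : V → ℝ, ∑ v, y v * ∑ u ∈ G.neighborFinset v, y u ≤ specRadius G * ∑ v, y v ^ 2) ∧
      ∃ x : V → ℝ, (∀ v, 0 ≤ x v) ∧ x ≠ 0 ∧
        ∀ v, ∑ u ∈ G.neighborFinset v, x u = specRadius G * x v := by
  classical
  obtain ⟨M, hM, hq, x, hx, hx0, hev⟩ := exists_nonneg_eigenvector_matrix (G.adjMatrix ℝ)
    (SimpleGraph.isSymm_adjMatrix G) (fun i j => by
      rw [SimpleGraph.adjMatrix_apply]; split_ifs <;> norm_num)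
  have hspec : specRadius G = M := by
    rw [← hM.csSup_eq, specRadius]
    congr!
  rw [hspec]
  refine ⟨fun y => ?_, x, hx, hx0, fun v => ?_⟩
  · simpa [dotProduct, SimpleGraph.adjMatrix_mulVec_apply, sq] using hq y
  · simpa [SimpleGraph.adjMatrix_mulVec_apply] using congrFun hev v

/-! ### Local structure of graphs without a `K_{2,3}` minor -/

section Minors

variable {V : Type*} {G : SimpleGraph V}

theorem isMinor_completeBipartiteGraph_two_three {X Y : Set V} {M : Fin 3 → Set V}
    (hX : (G.induce X).Connected) (hY : (G.induce Y).Connected)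
    (hM : ∀ i, (G.induce (M i)).Connected) (hXY : Disjoint X Y) (hXM : ∀ i, Disjoint X (M i))
    (hYM : ∀ i, Disjoint Y (M i)) (hMM : ∀ i j, i ≠ j → Disjoint (M i) (M j))
    (hXadj : ∀ i, ∃ x ∈ X, ∃ m ∈ M i, G.Adj x m) (hYadj : ∀ i, ∃ y ∈ Y, ∃ m ∈ M i, G.Adj y m) :
    IsMinor (completeBipartiteGraph (Fin 2) (Fin 3)) G := by
  have hXY' : ∀ a, (G.induce (![X, Y] a)).Connected ∧ (∀ i, Disjoint (![X, Y] a) (M i)) ∧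
      ∀ i, ∃ x ∈ ![X, Y] a, ∃ m ∈ M i, G.Adj x m := by
    intro a
    fin_cases a
    · exact ⟨hX, hXM, hXadj⟩
    · exact ⟨hY, hYM, hYadj⟩
  refine ⟨Sum.elim ![X, Y] M, ?_, ?_, ?_⟩
  · rintro (a | i)
    · exact (hXY' a).1
    · exact hM i
  · rintro (a | i) (b | j) h
    · have hab : a ≠ b := fun e => h (congrArg _ e)
      fin_cases a <;> fin_cases b
      · exact absurd rfl hab
      · exact hXY
      · exact hXY.symm
      · exact absurd rfl hab
    · exact (hXY' a).2.1 j
    · exact ((hXY' b).2.1 i).symm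
    · exact hMM i j fun e => h (congrArg _ e)
  · rintro (a | i) (b | j) h
    · simp at h
    · exact (hXY' a).2.2 j
    · obtain ⟨x, hx, m, hm, hxm⟩ := (hXY' b).2.2 i
      exact ⟨m, hm, x, hx, hxm.symm⟩
    · simp at h

theorem connected_induce_singleton (v : V) : (G.induce {v}).Connected := by
  simp

/-- Without a `K_{2,3}` minor, a vertex outside a connected set `X` has at most two neighbours
that lie outside `X` and are adjacent to `X`. -/
theorem card_le_two_of_connected (hG : ¬ IsMinor (completeBipartiteGraph (Fin 2) (Fin 3)) G)
    {X : Set V} (hX : (G.induce X).Connected) {v : V} (hv : v ∉ X) {s : Finset V}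
    (hs : ∀ u ∈ s, G.Adj v u ∧ u ∉ X ∧ ∃ x ∈ X, G.Adj x u) : #s ≤ 2 := by
  by_contra! hcard
  obtain ⟨f⟩ : Nonempty (Fin 3 ↪ s) :=
    Function.Embedding.nonempty_of_card_le (by simpa [Nat.succ_le_iff] using hcard)
  have hf : ∀ i, G.Adj v (f i) ∧ (f i : V) ∉ X ∧ ∃ x ∈ X, G.Adj x (f i) := fun i => hs _ (f i).2
  refine hG (isMinor_completeBipartiteGraph_two_three (X := X) (Y := {v})
    (M := fun i => {(f i : V)}) hX (connected_induce_singleton v)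
    (fun i => connected_induce_singleton _) ?_ ?_ ?_ ?_ ?_ ?_)
  · simpa using hv
  · intro i
    simpa using (hf i).2.1
  · intro i
    simpa using (hf i).1.ne
  · intro i j hij
    simpa [Subtype.val_inj] using hij
  · intro i
    simpa using (hf i).2.2
  · intro i
    simpa using (hf i).1

theorem card_inter_neighborFinset_le_two [Fintype V] [DecidableEq V] [DecidableRel G.Adj]
    (hG : ¬ IsMinor (completeBipartiteGraph (Fin 2) (Fin 3)) G) {u v : V} (huv : u ≠ v) :
    #(G.neighborFinset u ∩ G.neighborFinset v) ≤ 2 := by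
  refine card_le_two_of_connected hG (connected_induce_singleton v) (v := u) (by simpa using huv)
    fun z hz => ?_
  simp only [mem_inter, SimpleGraph.mem_neighborFinset] at hz
  exact ⟨hz.1, by simpa using hz.2.ne', by simpa using hz.2⟩

/-! ### A linear bound on the number of edges -/

theorem exists_adj_dist_eq {c u : V} {k : ℕ} (h : G.Reachable u c) (hk : G.dist u c = k + 1) :
    ∃ z, G.Adj u z ∧ G.Reachable z c ∧ G.dist z c = k := by
  obtain ⟨p, hp⟩ := h.exists_walk_length_eq_dist
  cases p with
  | nil => simp at hk
  | @cons _ z _ hz p =>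
    refine ⟨z, hz, ⟨p⟩, ?_⟩
    have h1 : G.dist z c ≤ p.length := SimpleGraph.dist_le p
    obtain ⟨q, hq⟩ := SimpleGraph.Reachable.exists_walk_length_eq_dist ⟨p⟩
    have h2 := SimpleGraph.dist_le (SimpleGraph.Walk.cons hz q)
    simp only [SimpleGraph.Walk.length_cons] at hp h2
    omega

theorem connected_induce_closedBall (c : V) (i : ℕ) :
    (G.induce {u | G.Reachable u c ∧ G.dist u c ≤ i}).Connected := by
  have hc : c ∈ {u | G.Reachable u c ∧ G.dist u c ≤ i} :=
    ⟨SimpleGraph.Reachable.refl c, by simp⟩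
  have key : ∀ k u, (hu : G.Reachable u c) → G.dist u c = k → (hk : G.dist u c ≤ i) →
      (G.induce {u | G.Reachable u c ∧ G.dist u c ≤ i}).Reachable ⟨u, hu, hk⟩ ⟨c, hc⟩ := by
    intro k
    induction k with
    | zero =>
      intro u hu h0 hk
      obtain rfl := hu.dist_eq_zero_iff.1 h0
      exact SimpleGraph.Reachable.refl _
    | succ k ih =>
      intro u hu h1 hk
      obtain ⟨z, huz, hz, hzk⟩ := exists_adj_dist_eq hu h1
      refine SimpleGraph.Reachable.trans (SimpleGraph.Adj.reachable ?_) (ih z hz hzk (by omega))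
      simpa using huz
  refine (SimpleGraph.connected_iff_exists_forall_reachable _).2 ⟨⟨c, hc⟩, ?_⟩
  rintro ⟨u, hu, hk⟩
  exact (key _ u hu rfl hk).symm

/-- A vertex outside the ball of radius `j` has at most two neighbours in the next sphere, because
the ball is connected and is adjacent to every vertex of that sphere. -/
theorem card_neighbors_sphere_le_two [Fintype V] [DecidableRel G.Adj]
    (hG : ¬ IsMinor (completeBipartiteGraph (Fin 2) (Fin 3)) G) (c v : V) (j : ℕ)
    (hv : j < G.dist v c) {s : Finset V}
    (hs : ∀ u ∈ s, G.Adj v u ∧ G.Reachable u c ∧ G.dist u c = j + 1) : #s ≤ 2 := by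
  refine card_le_two_of_connected hG (connected_induce_closedBall c j) (v := v)
    (fun h => ?_) fun u hu => ?_
  · have := h.2
    omega
  · obtain ⟨h1, h2, h3⟩ := hs u hu
    obtain ⟨z, hz, hzr, hzj⟩ := exists_adj_dist_eq h2 h3
    refine ⟨h1, fun h => ?_, z, ⟨hzr, hzj.le⟩, hz.symm⟩
    have := h.2
    omega

/-- A `K_{2,3}`-minor-free graph of order `n` has at most `4n` edges. Measure distances from one
chosen vertex in every component: each vertex has at most two neighbours in its own sphere and
at most two in the preceding one. -/
theorem sum_degree_le [Fintype V] [DecidableRel G.Adj]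
    (hG : ¬ IsMinor (completeBipartiteGraph (Fin 2) (Fin 3)) G) :
    ∑ v, G.degree v ≤ 8 * Fintype.card V := by
  classical
  set root : V → V := fun v => (G.connectedComponentMk v).out with hroot
  have hreach : ∀ v, G.Reachable v (root v) := fun v => by
    have h : G.connectedComponentMk (root v) = G.connectedComponentMk v := Quot.out_eq _
    exact (SimpleGraph.ConnectedComponent.exact h).symm
  have hadj : ∀ u v, G.Adj u v → root u = root v := fun u v h => by
    simp only [hroot, SimpleGraph.ConnectedComponent.connectedComponentMk_eq_of_adj h]
  set f : V → ℕ := fun v => G.dist v (root v) with hf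
  have hle : ∀ v, #{u ∈ (univ : Finset V) | G.Adj v u ∧ f u ≤ f v} ≤ 4 := by
    intro v
    set c := root v with hc
    have hcv : ∀ u, G.Adj v u → G.Reachable u c ∧ f u = G.dist u c := fun u hu => by
      have : root u = c := (hadj _ _ hu).symm
      exact ⟨this ▸ hreach u, by simp only [hf, this]⟩
    have hfv : f v = G.dist v c := rfl
    have hsphere : ∀ j, j < f v → #{u ∈ (univ : Finset V) | G.Adj v u ∧ f u = j + 1} ≤ 2 := by
      intro j hj
      refine card_neighbors_sphere_le_two hG c v j hj fun u hu => ?_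
      simp only [mem_filter, mem_univ, true_and] at hu
      exact ⟨hu.1, (hcv u hu.1).1, (hcv u hu.1).2 ▸ hu.2⟩
    have hzero : #{u ∈ (univ : Finset V) | G.Adj v u ∧ f u = 0} ≤ 1 := by
      have hc' : ∀ u ∈ ({u ∈ (univ : Finset V) | G.Adj v u ∧ f u = 0} : Finset V), u = c := by
        intro u hu
        simp only [mem_filter, mem_univ, true_and] at hu
        exact (hcv u hu.1).1.dist_eq_zero_iff.1 ((hcv u hu.1).2 ▸ hu.2)
      exact card_le_one.2 fun a ha b hb => (hc' a ha).trans (hc' b hb).symm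
    have hstep : ∀ u, G.Adj v u → f v ≤ f u + 1 := by
      intro u hu
      obtain ⟨q, hq⟩ := (hcv u hu).1.exists_walk_length_eq_dist
      have h2 := SimpleGraph.dist_le (SimpleGraph.Walk.cons hu q)
      rw [SimpleGraph.Walk.length_cons, hq, ← (hcv u hu).2] at h2
      exact h2
    rcases Nat.eq_zero_or_pos (f v) with h0 | h0
    · calc _ ≤ #{u ∈ (univ : Finset V) | G.Adj v u ∧ f u = 0} := by
            apply card_le_card
            intro u
            simp only [mem_filter, mem_univ, true_and]
            rintro ⟨h1, h2⟩
            exact ⟨h1, by omega⟩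
        _ ≤ 4 := by omega
    · obtain ⟨j, hj⟩ : ∃ j, f v = j + 1 := ⟨f v - 1, by omega⟩
      have hprev : #{u ∈ (univ : Finset V) | G.Adj v u ∧ f u = j} ≤ 2 := by
        rcases Nat.eq_zero_or_pos j with rfl | hj0
        · omega
        · obtain ⟨i, rfl⟩ : ∃ i, j = i + 1 := ⟨j - 1, by omega⟩
          exact hsphere i (by omega)
      calc _ ≤ #({u ∈ (univ : Finset V) | G.Adj v u ∧ f u = j + 1} ∪
              {u ∈ (univ : Finset V) | G.Adj v u ∧ f u = j}) := by
            apply card_le_card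
            intro u
            simp only [mem_union, mem_filter, mem_univ, true_and]
            rintro ⟨h1, h2⟩
            have := hstep u h1
            have : f u = j + 1 ∨ f u = j := by omega
            tauto
        _ ≤ _ := card_union_le _ _
        _ ≤ 4 := by
            have := hsphere j (by omega)
            omega
  have hsplit : ∀ v, G.degree v ≤ #{u ∈ (univ : Finset V) | G.Adj v u ∧ f u ≤ f v} +
      #{u ∈ (univ : Finset V) | G.Adj u v ∧ f v ≤ f u} := by
    intro v
    rw [← SimpleGraph.card_neighborFinset_eq_degree]
    refine le_trans (card_le_card ?_) (card_union_le _ _)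
    intro u
    simp only [SimpleGraph.mem_neighborFinset, mem_union, mem_filter, mem_univ, true_and,
      G.adj_comm u v]
    intro h
    rcases le_total (f u) (f v) with h' | h' <;> tauto
  have hswap : ∑ v, #{u ∈ (univ : Finset V) | G.Adj u v ∧ f v ≤ f u} =
      ∑ v, #{u ∈ (univ : Finset V) | G.Adj v u ∧ f u ≤ f v} :=
    (sum_card_bipartiteAbove_eq_sum_card_bipartiteBelow
      (fun v u => G.Adj v u ∧ f u ≤ f v) (s := univ) (t := univ)).symm
  calc ∑ v, G.degree v ≤ ∑ v, (#{u ∈ (univ : Finset V) | G.Adj v u ∧ f u ≤ f v} +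
      #{u ∈ (univ : Finset V) | G.Adj u v ∧ f v ≤ f u}) := sum_le_sum fun v _ => hsplit v
    _ = 2 * ∑ v, #{u ∈ (univ : Finset V) | G.Adj v u ∧ f u ≤ f v} := by
      rw [sum_add_distrib, hswap, two_mul]
    _ ≤ 2 * ∑ _v : V, 4 := by
      gcongr
      exact hle _
    _ = _ := by simp; ring

end Minors

/-! ### The extremal graph -/

section Extremal

variable {n : ℕ}

@[simp] theorem extremalGraph_adj_inl_inl (t : ℕ) (a b : Fin 1) :
    ¬ (extremalGraph t n).Adj (.inl a) (.inl b) := by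
  simp [extremalGraph, join, Subsingleton.elim a b]

@[simp] theorem extremalGraph_adj_inl_inr (t : ℕ) (a : Fin 1) (z) :
    (extremalGraph t n).Adj (.inl a) (.inr z) := by
  simp [extremalGraph, join]

@[simp] theorem extremalGraph_adj_inr_inl (t : ℕ) (a : Fin 1) (z) :
    (extremalGraph t n).Adj (.inr z) (.inl a) := by
  simp [extremalGraph, join]

@[simp] theorem extremalGraph_adj_block_block (t : ℕ) (i j : Fin ((n - 1) / t)) (a b : Fin t) :
    (extremalGraph t n).Adj (.inr (.inl (i, a))) (.inr (.inl (j, b))) ↔ i = j ∧ a ≠ b := by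
  simp [extremalGraph, join, copies]

@[simp] theorem extremalGraph_adj_block_rest (t : ℕ) (z a) :
    ¬ (extremalGraph t n).Adj (.inr (.inl z)) (.inr (.inr a)) := by
  simp [extremalGraph, join]

@[simp] theorem extremalGraph_adj_rest_block (t : ℕ) (z a) :
    ¬ (extremalGraph t n).Adj (.inr (.inr a)) (.inr (.inl z)) := by
  simp [extremalGraph, join]

@[simp] theorem extremalGraph_adj_rest_rest (t : ℕ) (a b : Fin ((n - 1) % t)) :
    (extremalGraph t n).Adj (.inr (.inr a)) (.inr (.inr b)) ↔ a ≠ b := by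
  simp [extremalGraph, join]

/-- The block of `K_1 ∨ (p K_3 + K_s)` minus its hub that contains a given vertex; the hub itself
has no block. -/
def block (n : ℕ) : Fin 1 ⊕ (Fin ((n - 1) / 3) × Fin 3 ⊕ Fin ((n - 1) % 3)) →
    Option (Fin ((n - 1) / 3) ⊕ Unit)
  | .inl _ => none
  | .inr (.inl z) => some (.inl z.1)
  | .inr (.inr _) => some (.inr ())

theorem block_eq_of_adj {u v} (h : (extremalGraph 3 n).Adj u v) (hu : block n u ≠ none)
    (hv : block n v ≠ none) : block n u = block n v := by
  rcases u with u | ⟨i, a⟩ | a <;> rcases v with v | ⟨j, b⟩ | b <;> simp_all [block]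

theorem card_le_three_of_block_eq (s : Finset (Fin 1 ⊕ (Fin ((n - 1) / 3) × Fin 3 ⊕
    Fin ((n - 1) % 3)))) (hne : ∀ u ∈ s, block n u ≠ none)
    (hs : ∀ u ∈ s, ∀ v ∈ s, block n u = block n v) : #s ≤ 3 := by
  -- the position of a vertex inside its block, which determines it within that block
  let pos : Fin 1 ⊕ (Fin ((n - 1) / 3) × Fin 3 ⊕ Fin ((n - 1) % 3)) → ℕ :=
    Sum.elim (fun _ => 0) (Sum.elim (fun z => z.2) (fun a => a))
  have hpos : ∀ u, pos u ∈ range 3 := by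
    rintro (u | ⟨i, a⟩ | a)
    · simp [pos]
    · simp [pos]
    · have := a.2
      simp only [pos, mem_range, Sum.elim_inr]
      omega
  have hinj : Set.InjOn pos s := by
    intro u hu v hv huv
    have h1 := hs u hu v hv
    have h2 := hne u hu
    have h3 := hne v hv
    rcases u with u | ⟨i, a⟩ | a
    · exact absurd rfl h2
    all_goals rcases v with v | ⟨j, b⟩ | b
    · exact absurd rfl h3
    · simp only [block, Option.some.injEq, Sum.inl.injEq] at h1
      simp only [pos, Sum.elim_inr, Sum.elim_inl] at huv
      rw [h1, Fin.ext huv]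
    · simp [block] at h1
    · exact absurd rfl h3
    · simp [block] at h1
    · simp only [pos, Sum.elim_inr] at huv
      rw [Fin.ext huv]
  simpa using card_le_card_of_injOn pos (fun u _ => hpos u) hinj

theorem block_eq_of_connected
    {B : Set (Fin 1 ⊕ (Fin ((n - 1) / 3) × Fin 3 ⊕ Fin ((n - 1) % 3)))}
    (hB : ((extremalGraph 3 n).induce B).Connected) (hne : ∀ u ∈ B, block n u ≠ none)
    {u v} (hu : u ∈ B) (hv : v ∈ B) : block n u = block n v := by
  obtain ⟨p⟩ := hB.preconnected ⟨u, hu⟩ ⟨v, hv⟩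
  have key : ∀ (a b : B) (_ : ((extremalGraph 3 n).induce B).Walk a b),
      block n a = block n b := by
    intro a b p
    induction p with
    | nil => rfl
    | cons h _ ih => exact (block_eq_of_adj (by simpa using h) (hne _ (Subtype.prop _))
        (hne _ (Subtype.prop _))).trans ih
  exact key _ _ p

/-- Only one branch set of a minor can contain the hub. The other four branch sets of a
`K_{2,3}` minor would be linked to each other, hence lie in one block, which has at most three
vertices. -/
theorem not_isMinor_extremalGraph (n : ℕ) :
    ¬ IsMinor (completeBipartiteGraph (Fin 2) (Fin 3)) (extremalGraph 3 n) := by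
  rintro ⟨B, hcon, hdis, hadj⟩
  have hrep : ∀ j, ∃ x, x ∈ B j := fun j => by
    obtain ⟨x⟩ := (hcon j).nonempty
    exact ⟨x.1, x.2⟩
  choose x hx using hrep
  obtain ⟨k, hk⟩ : ∃ k, ∀ j ≠ k, ∀ u ∈ B j, block n u ≠ none := by
    have hhub : ∀ u, block n u = none → u = .inl 0 := by
      rintro (u | ⟨i, a⟩ | a) h
      · rw [Subsingleton.elim u 0]
      · simp [block] at h
      · simp [block] at h
    by_cases h : ∃ k, .inl 0 ∈ B k
    · obtain ⟨k, hk⟩ := h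
      refine ⟨k, fun j hj u hu hn => ?_⟩
      rw [hhub u hn] at hu
      exact Set.disjoint_left.1 (hdis j k hj) hu hk
    · exact ⟨.inl 0, fun j _ u hu hn => h ⟨j, hhub u hn ▸ hu⟩⟩
  have hlr : ∀ i j, .inl i ≠ k → .inr j ≠ k →
      block n (x (.inl i)) = block n (x (.inr j)) := by
    intro i j hi hj
    obtain ⟨a, ha, b, hb, hab⟩ := hadj (.inl i) (.inr j) (by simp)
    rw [block_eq_of_connected (hcon _) (hk _ hi) (hx _) ha,
      block_eq_of_connected (hcon _) (hk _ hj) (hx _) hb]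
    exact block_eq_of_adj hab (hk _ hi a ha) (hk _ hj b hb)
  have hall : ∀ i j, i ≠ k → j ≠ k → block n (x i) = block n (x j) := by
    rintro (i | i) (j | j) hi hj
    · obtain ⟨l, hl⟩ : ∃ l : Fin 3, (.inr l : Fin 2 ⊕ Fin 3) ≠ k := by
        by_contra! h
        exact absurd ((h 0).trans (h 1).symm) (by simp)
      exact (hlr i l hi hl).trans (hlr j l hj hl).symm
    · exact hlr i j hi hj
    · exact (hlr j i hj hi).symm
    · obtain ⟨l, hl⟩ : ∃ l : Fin 2, (.inl l : Fin 2 ⊕ Fin 3) ≠ k := by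
        by_contra! h
        exact absurd ((h 0).trans (h 1).symm) (by simp)
      exact (hlr l i hl hi).symm.trans (hlr l j hl hj)
  have hinj : Function.Injective x := by
    intro i j hij
    by_contra hne
    exact Set.disjoint_left.1 (hdis i j hne) (hx i) (hij ▸ hx j)
  have h := card_le_three_of_block_eq ((univ.erase k).map ⟨x, hinj⟩) (by
      simp only [mem_map, mem_erase, mem_univ, and_true, Function.Embedding.coeFn_mk]
      rintro _ ⟨j, hj, rfl⟩
      exact hk j hj _ (hx j)) (by
      simp only [mem_map, mem_erase, mem_univ, and_true, Function.Embedding.coeFn_mk]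
      rintro _ ⟨i, hi, rfl⟩ _ ⟨j, hj, rfl⟩
      exact hall i j hi hj)
  simp at h

/-- The quadratic form of `K_1 ∨ (p K_3 + K_s)` and the squared norm, for a vector that is constant
on the union of the triangles and on `K_s`. -/
theorem quadraticForm_extremalGraph [DecidableRel (extremalGraph 3 n).Adj] (a c d : ℝ) :
    let y : Fin 1 ⊕ (Fin ((n - 1) / 3) × Fin 3 ⊕ Fin ((n - 1) % 3)) → ℝ :=
      Sum.elim (fun _ => a) (Sum.elim (fun _ => c) (fun _ => d))
    (∑ v, y v * ∑ u ∈ (extremalGraph 3 n).neighborFinset v, y u =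
      a * (3 * ((n - 1) / 3 : ℕ) * c + ((n - 1) % 3 : ℕ) * d) +
      3 * ((n - 1) / 3 : ℕ) * (c * (a + 2 * c)) +
      ((n - 1) % 3 : ℕ) * (d * (a + (((n - 1) % 3 : ℕ) - 1) * d))) ∧
    ∑ v, y v ^ 2 = a ^ 2 + 3 * ((n - 1) / 3 : ℕ) * c ^ 2 + ((n - 1) % 3 : ℕ) * d ^ 2 := by
  intro y
  have hnb : ∀ v, ∑ u ∈ (extremalGraph 3 n).neighborFinset v, y u =
      ∑ u, if (extremalGraph 3 n).Adj v u then y u else 0 := by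
    intro v
    rw [← Finset.sum_filter]
    congr 1
    ext u
    simp
  have h1 : ∀ z, ∑ u ∈ (extremalGraph 3 n).neighborFinset (.inl z), y u =
      3 * ((n - 1) / 3 : ℕ) * c + ((n - 1) % 3 : ℕ) * d := by
    intro z
    rw [hnb]
    simp [y, -mul_eq_mul_right_iff]
    ring
  have h2 : ∀ z, ∑ u ∈ (extremalGraph 3 n).neighborFinset (.inr (.inl z)), y u = a + 2 * c := by
    rintro ⟨i, b⟩
    rw [hnb]
    simp only [Fintype.sum_sum_type, Fintype.sum_prod_type, extremalGraph_adj_inr_inl,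
      extremalGraph_adj_block_block, extremalGraph_adj_block_rest, y]
    simp [ite_and, Finset.sum_ite_eq, Finset.sum_ite, Finset.filter_ne]
  have h3 : ∀ z, ∑ u ∈ (extremalGraph 3 n).neighborFinset (.inr (.inr z)), y u =
      a + (((n - 1) % 3 : ℕ) - 1) * d := by
    intro z
    have hz : 1 ≤ (n - 1) % 3 := by have := z.2; omega
    rw [hnb]
    simp only [Fintype.sum_sum_type, extremalGraph_adj_inr_inl,
      extremalGraph_adj_rest_block, extremalGraph_adj_rest_rest, y]
    simp [Finset.sum_ite, Finset.filter_ne, Nat.cast_sub hz]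
  constructor
  · simp only [Fintype.sum_sum_type, h1, h2, h3]
    simp [y]
    ring
  · simp [y]
    ring

theorem two_hundred_le_specRadius_extremalGraph (hn : 40000 < n) :
    200 ≤ specRadius (extremalGraph 3 n) := by
  classical
  have h := (specRadius_spec (extremalGraph 3 n)).1
    (Sum.elim (fun _ => 200) (Sum.elim (fun _ => 1) (fun _ => 1)))
  obtain ⟨h1, h2⟩ := quadraticForm_extremalGraph (n := n) 200 1 1
  rw [h1, h2] at h
  have hm : (40000 : ℝ) ≤ 3 * ((n - 1) / 3 : ℕ) + ((n - 1) % 3 : ℕ) := by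
    have : 40000 ≤ 3 * ((n - 1) / 3) + (n - 1) % 3 := by omega
    exact_mod_cast this
  have hs : (0 : ℝ) ≤ ((n - 1) % 3 : ℕ) * ((n - 1) % 3 : ℕ) := by positivity
  have hp : (0 : ℝ) ≤ ((n - 1) / 3 : ℕ) := by positivity
  have hp' : (((n - 1) % 3 : ℕ) : ℝ) ≤ 2 := by
    have : (n - 1) % 3 ≤ 2 := by omega
    exact_mod_cast this
  by_contra! hlt
  generalize (((n - 1) % 3 : ℕ) : ℝ) = s at *
  generalize (((n - 1) / 3 : ℕ) : ℝ) = p at *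
  have h4 : specRadius (extremalGraph 3 n) * (200 ^ 2 + 3 * p * 1 ^ 2 + s * 1 ^ 2) ≤
      200 * (200 ^ 2 + 3 * p * 1 ^ 2 + s * 1 ^ 2) :=
    mul_le_mul_of_nonneg_right hlt.le (by linarith)
  linarith

/-- The vector that is `1` on the hub and solves the eigenvalue equation for `μ` at all other
vertices shows that `μ ^ 2 - 2 * μ` is almost at least `n - 1`. -/
theorem le_of_specRadius_extremalGraph_le (hn : 1 ≤ n) {μ : ℝ} (hμ2 : 2 < μ)
    (hμ : specRadius (extremalGraph 3 n) ≤ μ) :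
    (n : ℝ) - 1 - 2 / (μ - 1) ≤ μ ^ 2 - 2 * μ := by
  classical
  -- The vector yields the error term `s * (3 - s) / (μ + 1 - s)`, where `s = (n - 1) % 3`; it is
  -- largest for `s = 2`.
  have hs : (((n - 1) % 3 : ℕ) : ℝ) * (3 - ((n - 1) % 3 : ℕ)) / (μ + 1 - ((n - 1) % 3 : ℕ)) ≤
      2 / (μ - 1) := by
    have h3 : (n - 1) % 3 < 3 := Nat.mod_lt _ (by norm_num)
    generalize (n - 1) % 3 = s at h3 ⊢
    interval_cases s
    · rw [Nat.cast_zero, zero_mul, zero_div]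
      exact div_nonneg (by norm_num) (by linarith)
    · rw [Nat.cast_one]
      exact div_le_div₀ (by norm_num) (by norm_num) (by linarith) (by linarith)
    · refine le_of_eq ?_
      congr 1 <;> push_cast <;> ring
  have hnm : (n : ℝ) - 1 = 3 * ((n - 1) / 3 : ℕ) + ((n - 1) % 3 : ℕ) := by
    have : n = 3 * ((n - 1) / 3) + (n - 1) % 3 + 1 := by omega
    rw [sub_eq_iff_eq_add]
    exact_mod_cast this
  have hp' : (((n - 1) % 3 : ℕ) : ℝ) ≤ 2 := by
    have : (n - 1) % 3 ≤ 2 := by omega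
    exact_mod_cast this
  have hs0 : (0 : ℝ) ≤ ((n - 1) % 3 : ℕ) := by positivity
  have hp0 : (0 : ℝ) ≤ ((n - 1) / 3 : ℕ) := by positivity
  obtain ⟨h1, h2⟩ := quadraticForm_extremalGraph (n := n) 1 (μ - 2)⁻¹
    (μ + 1 - ((n - 1) % 3 : ℕ))⁻¹
  have h := (specRadius_spec (extremalGraph 3 n)).1
    (Sum.elim (fun _ => 1) (Sum.elim (fun _ => (μ - 2)⁻¹)
      (fun _ => (μ + 1 - ((n - 1) % 3 : ℕ))⁻¹)))
  have hnonneg : 0 ≤ ∑ v, (Sum.elim (fun _ => 1) (Sum.elim (fun _ => (μ - 2)⁻¹)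
      (fun _ => (μ + 1 - ((n - 1) % 3 : ℕ))⁻¹)) : Fin 1 ⊕ (Fin ((n - 1) / 3) × Fin 3 ⊕
        Fin ((n - 1) % 3)) → ℝ) v ^ 2 := Finset.sum_nonneg fun v _ => sq_nonneg _
  have h' := h.trans (mul_le_mul_of_nonneg_right hμ hnonneg)
  rw [h1, h2] at h'
  rw [hnm]
  generalize (((n - 1) % 3 : ℕ) : ℝ) = s at *
  generalize (((n - 1) / 3 : ℕ) : ℝ) = p at *
  have ha : 0 < μ - 2 := by linarith
  have hb : 0 < μ + 1 - s := by linarith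
  have hc1 : (μ - 2)⁻¹ * (μ - 2) = 1 := inv_mul_cancel₀ ha.ne'
  have hd1 : (μ + 1 - s)⁻¹ * (μ + 1 - s) = 1 := inv_mul_cancel₀ hb.ne'
  rw [div_eq_mul_inv] at hs
  set c := (μ - 2)⁻¹
  set d := (μ + 1 - s)⁻¹
  have hc : 1 + 2 * c = μ * c := by linarith
  have hd : 1 + (s - 1) * d = μ * d := by linarith
  rw [hc, hd] at h'
  have h3 : 3 * p * c + s * d ≤ μ := by linarith
  have h4 := mul_le_mul_of_nonneg_right h3 ha.le
  have e1 : (3 * p * c + s * d) * (μ - 2) = 3 * p * (c * (μ - 2)) +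
      s * (d * (μ + 1 - s)) - s * (3 - s) * d := by ring
  rw [e1, hc1, hd1] at h4
  linarith

end Extremal

/-! ### A dominating vertex -/

section Dominating

variable {V : Type*} [Fintype V] [DecidableEq V] {G : SimpleGraph V} [DecidableRel G.Adj]

/-- The eigenvalue equation for the square of the adjacency matrix, whose entries count common
neighbours. -/
theorem sq_mul_eq_sum_card_inter_mul {x : V → ℝ} {μ : ℝ}
    (hev : ∀ v, ∑ u ∈ G.neighborFinset v, x u = μ * x v) (u : V) :
    μ ^ 2 * x u = G.degree u * x u +
      ∑ z ∈ univ.erase u, (#(G.neighborFinset u ∩ G.neighborFinset z) : ℝ) * x z := by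
  have h1 : μ ^ 2 * x u = ∑ z, (#(G.neighborFinset u ∩ G.neighborFinset z) : ℝ) * x z := by
    calc μ ^ 2 * x u = ∑ v ∈ G.neighborFinset u, ∑ z ∈ G.neighborFinset v, x z := by
          simp only [hev]
          rw [← mul_sum, hev]
          ring
      _ = ∑ z, ∑ v ∈ G.neighborFinset u ∩ G.neighborFinset z, x z := by
          refine sum_comm' fun v z => ?_
          simp only [SimpleGraph.mem_neighborFinset, mem_inter, mem_univ, and_true]
          rw [G.adj_comm v z]
      _ = _ := by simp
  rw [h1, ← add_sum_erase _ _ (mem_univ u), inter_self,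
    SimpleGraph.card_neighborFinset_eq_degree]

/-- A vertex where the nonnegative eigenvector is maximal is adjacent to all others. The linear
bound on the number of edges makes the sum of the entries of order `μ`, while `μ ^ 2` is of
order `n`; as two vertices have at most two common neighbours, this leaves room for only one vertex
of large degree, and all other entries are small. The equation for `μ ^ 2` at `w` then loses a
definite amount for every vertex that is not adjacent to `w`. -/
theorem adj_of_isMax (hG : ¬ IsMinor (completeBipartiteGraph (Fin 2) (Fin 3)) G)
    {x : V → ℝ} {μ : ℝ} {w : V} (hμ : 200 ≤ μ) (hx0 : ∀ v, 0 ≤ x v) (hx1 : ∀ v, x v ≤ 1)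
    (hxw : x w = 1) (hev : ∀ v, ∑ u ∈ G.neighborFinset v, x u = μ * x v)
    (hn : (Fintype.card V : ℝ) - 1 - 2 / (μ - 1) ≤ μ ^ 2 - 2 * μ) {v : V} (hv : v ≠ w) :
    G.Adj w v := by
  have hε : 2 / (μ - 1) ≤ 1 / 4 := by
    rw [div_le_iff₀ (by linarith)]
    linarith
  generalize 2 / (μ - 1) = ε at *
  have hcod : ∀ u z : V, u ≠ z →
      (#(G.neighborFinset u ∩ G.neighborFinset z) : ℝ) ≤ 2 := fun u z h => by
    exact_mod_cast card_inter_neighborFinset_le_two hG h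
  -- the sum of all entries
  have hsum : ∑ z, x z ≤ 8 * μ := by
    have h1 : μ * ∑ z, x z ≤ 8 * μ ^ 2 := by
      calc μ * ∑ z, x z = ∑ v, ∑ u ∈ G.neighborFinset v, x u := by
            rw [mul_sum]
            exact sum_congr rfl fun v _ => (hev v).symm
        _ ≤ ∑ v, (G.degree v : ℝ) := by
            refine sum_le_sum fun v _ => ?_
            rw [← SimpleGraph.card_neighborFinset_eq_degree]
            simpa using sum_le_card_nsmul (G.neighborFinset v) x 1 fun u _ => hx1 u
        _ ≤ 8 * Fintype.card V := by exact_mod_cast sum_degree_le hG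
        _ ≤ _ := by linarith
    have h2 : μ * ∑ z, x z ≤ μ * (8 * μ) := by linarith
    exact le_of_mul_le_mul_left h2 (by linarith)
  have hsq : ∀ u, μ ^ 2 * x u ≤ G.degree u * x u + 16 * μ := by
    intro u
    rw [sq_mul_eq_sum_card_inter_mul hev u]
    have : ∑ z ∈ univ.erase u, (#(G.neighborFinset u ∩ G.neighborFinset z) : ℝ) * x z ≤
        2 * ∑ z, x z := by
      rw [mul_sum]
      refine (sum_le_sum fun z hz => mul_le_mul_of_nonneg_right
        (hcod u z (ne_of_mem_erase hz).symm) (hx0 z)).trans ?_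
      exact sum_le_sum_of_subset_of_nonneg (subset_univ _) fun z _ _ =>
        mul_nonneg zero_le_two (hx0 z)
    linarith
  -- the vertices that are not adjacent to `w`
  set K := (univ.erase w) \ G.neighborFinset w with hK
  have hsub : G.neighborFinset w ⊆ univ.erase w := fun u hu => by
    simpa using ((G.mem_neighborFinset w u).1 hu).ne'
  have hKcard : (#K : ℝ) + G.degree w = Fintype.card V - 1 := by
    have h1 := card_sdiff_add_card_eq_card hsub
    rw [card_erase_of_mem (mem_univ w), card_univ,
      SimpleGraph.card_neighborFinset_eq_degree] at h1
    have h2 : 1 ≤ Fintype.card V := Fintype.card_pos_iff.2 ⟨w⟩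
    rw [← Nat.cast_one, ← Nat.cast_sub h2, ← h1]
    push_cast
    rfl
  have hdw := hsq w
  rw [hxw, mul_one, mul_one] at hdw
  have hsmall : ∀ u, u ≠ w → x u ≤ 1 / 4 := by
    intro u hu
    have hdeg : (G.degree u : ℝ) ≤ 3 + #K := by
      have h1 : G.neighborFinset u ⊆
          ((G.neighborFinset u ∩ G.neighborFinset w) ∪ {w}) ∪ K := by
        intro z hz
        by_cases h2 : z = w
        · simp [h2]
        · by_cases h3 : z ∈ G.neighborFinset w
          · simp only [mem_union, mem_inter]
            exact Or.inl (Or.inl ⟨hz, h3⟩)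
          · simp only [mem_union, hK, mem_sdiff, mem_erase, mem_univ, and_true]
            exact Or.inr ⟨h2, h3⟩
      have h2 := (card_le_card h1).trans ((card_union_le _ _).trans
        (Nat.add_le_add_right (card_union_le _ _) _))
      have h3 := card_inter_neighborFinset_le_two hG hu
      rw [SimpleGraph.card_neighborFinset_eq_degree, card_singleton] at h2
      have h4 : G.degree u ≤ 3 + #K := by omega
      exact_mod_cast h4
    have h1 := hsq u
    have h2 : (G.degree u : ℝ) * x u ≤ (14 * μ + 4) * x u :=
      mul_le_mul_of_nonneg_right (by linarith) (hx0 u)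
    by_contra! hlt
    have h3 : 0 ≤ (μ ^ 2 - 14 * μ - 4) * (x u - 1 / 4) :=
      mul_nonneg (by nlinarith) (by linarith)
    nlinarith
  have hmain : μ ^ 2 ≤ G.degree w + (2 * μ + #K * (1 / 2)) := by
    have h1 := sq_mul_eq_sum_card_inter_mul hev w
    rw [hxw, mul_one, mul_one] at h1
    rw [h1, ← sum_sdiff hsub, add_comm (2 * μ)]
    gcongr
    · rw [← nsmul_eq_mul]
      refine sum_le_card_nsmul _ _ _ fun z hz => ?_
      have hz' : z ≠ w := by
        rw [mem_sdiff] at hz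
        exact ne_of_mem_erase hz.1
      have h2 := mul_le_mul (hcod w z hz'.symm) (hsmall z hz') (hx0 z) zero_le_two
      linarith
    · have h2 := hev w
      rw [hxw, mul_one] at h2
      rw [← h2, mul_sum]
      exact sum_le_sum fun z hz => mul_le_mul_of_nonneg_right
        (hcod w z ((G.mem_neighborFinset w z).1 hz).ne) (hx0 z)
  have hK0 : K = ∅ := by
    by_contra hne
    have h1 : (1 : ℝ) ≤ #K := by
      exact_mod_cast card_pos.2 (nonempty_iff_ne_empty.2 hne)
    linarith
  by_contra hadj
  have : v ∈ K := by simp [hK, hv, hadj]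
  simp [hK0] at this

end Dominating

/-! ### Graphs with a dominating vertex -/

section Cone

variable {V : Type*} [Fintype V] [DecidableEq V]

/-- The neighbours of `v` other than `w`, that is, the neighbours of `v` in `G - w` if `v ≠ w`. -/
def neighborsOff (G : SimpleGraph V) [DecidableRel G.Adj] (w v : V) : Finset V :=
  (G.neighborFinset v).erase w

variable {G : SimpleGraph V} [DecidableRel G.Adj] {w : V}

@[simp] theorem mem_neighborsOff {u v : V} : u ∈ neighborsOff G w v ↔ u ≠ w ∧ G.Adj v u := by
  simp [neighborsOff]

theorem card_neighborsOff_le_two (hG : ¬ IsMinor (completeBipartiteGraph (Fin 2) (Fin 3)) G)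
    (hw : ∀ v, v ≠ w → G.Adj w v) {v : V} (hv : v ≠ w) : #(neighborsOff G w v) ≤ 2 := by
  refine (card_le_card fun u hu => ?_).trans (card_inter_neighborFinset_le_two hG hv)
  rw [mem_neighborsOff] at hu
  simpa using ⟨hu.2, hw u hu.1⟩

/-- If `S` is a union of components of `G - w` in which all degrees are two, then these components
are triangles. Otherwise some `v ∈ S` has nonadjacent neighbours `a` and `b`. By the handshaking
lemma, the component of the other neighbour `a'` of `a` in `S \ {v, a, b}` is adjacent to `b`, so
`a` and `b` have the three connected sets `{v}`, `{w}` and this component in common as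
neighbours. -/
theorem adj_of_mem_neighborsOff (hG : ¬ IsMinor (completeBipartiteGraph (Fin 2) (Fin 3)) G)
    (hw : ∀ v, v ≠ w → G.Adj w v) {S : Finset V} (hwS : w ∉ S)
    (hS : ∀ u ∈ S, neighborsOff G w u ⊆ S) (hS2 : ∀ u ∈ S, #(neighborsOff G w u) = 2)
    {v a b : V} (hv : v ∈ S) (ha : a ∈ neighborsOff G w v) (hb : b ∈ neighborsOff G w v)
    (hab : a ≠ b) : G.Adj a b := by
  by_contra hnadj
  have hneS : ∀ u ∈ S, u ≠ w := fun u hu h => hwS (h ▸ hu)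
  have haS := hS v hv ha
  have hbS := hS v hv hb
  have hvw := hneS v hv
  rw [mem_neighborsOff] at ha hb
  have hNv : ∀ u, u ≠ w → G.Adj v u → u = a ∨ u = b := by
    have h : {a, b} = neighborsOff G w v := by
      refine eq_of_subset_of_card_le (fun u hu => ?_) ?_
      · rw [mem_insert, mem_singleton] at hu
        rcases hu with rfl | rfl <;> simpa
      · rw [hS2 v hv, card_pair hab]
    intro u hu huv
    have : u ∈ ({a, b} : Finset V) := by
      rw [h]
      simp [hu, huv]
    simpa using this
  obtain ⟨a', ha'mem, ha'v⟩ : ∃ a' ∈ neighborsOff G w a, a' ≠ v :=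
    exists_mem_ne (by rw [hS2 a haS]; norm_num) v
  have ha'S := hS a haS ha'mem
  rw [mem_neighborsOff] at ha'mem
  have hNa : ∀ u, u ≠ w → G.Adj a u → u = v ∨ u = a' := by
    have h : {v, a'} = neighborsOff G w a := by
      refine eq_of_subset_of_card_le (fun u hu => ?_) ?_
      · rw [mem_insert, mem_singleton] at hu
        rcases hu with rfl | rfl
        · simpa [hvw] using ha.2.symm
        · simpa using ha'mem
      · rw [hS2 a haS, card_pair ha'v.symm]
    intro u hu huv
    have : u ∈ ({v, a'} : Finset V) := by
      rw [h]
      simp [hu, huv]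
    simpa using this
  have ha'b : a' ≠ b := fun h => hnadj (h ▸ ha'mem.2)
  have ha'a : a' ≠ a := ha'mem.2.ne'
  -- `R` is the component of `a'` in `S \ {v, a, b}`
  set U : Set V := {u | u ∈ S ∧ u ≠ v ∧ u ≠ a ∧ u ≠ b} with hU
  set R : Set V := {u | Relation.ReflTransGen (fun y z => G.Adj y z ∧ z ∈ U) a' u} with hR
  have ha'R : a' ∈ R := Relation.ReflTransGen.refl
  have hRU : ∀ u ∈ R, u ∈ U := by
    intro u hu
    induction hu with
    | refl => exact ⟨ha'S, ha'v, ha'a, ha'b⟩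
    | tail _ h _ => exact h.2
  have hRclosed : ∀ u ∈ R, ∀ z ∈ U, G.Adj u z → z ∈ R := fun u hu z hz h =>
    Relation.ReflTransGen.tail hu ⟨h, hz⟩
  have hRcon : (G.induce R).Connected := by
    refine (SimpleGraph.connected_iff_exists_forall_reachable _).2 ⟨⟨a', ha'R⟩, ?_⟩
    rintro ⟨u, hu⟩
    induction hu with
    | refl => exact SimpleGraph.Reachable.refl _
    | @tail y z hy h ih =>
      refine SimpleGraph.Reachable.trans (ih : (G.induce R).Reachable _ ⟨y, hy⟩)
        (SimpleGraph.Adj.reachable ?_)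
      simpa using h.1
  have hRb : ∃ u ∈ R, G.Adj b u := by
    classical
    by_contra! hno
    let K : SimpleGraph V :=
      { Adj := fun y z => G.Adj y z ∧ y ∈ R ∧ z ∈ R
        symm := ⟨fun _ _ h => ⟨h.1.symm, h.2.2, h.2.1⟩⟩
        loopless := ⟨fun _ h => h.1.ne rfl⟩ }
    have hKN : ∀ u ∈ R, K.neighborFinset u = (neighborsOff G w u).erase a := by
      intro u hu
      obtain ⟨huS, huv, hua, hub⟩ := hRU u hu
      ext z
      simp only [SimpleGraph.mem_neighborFinset, mem_erase, mem_neighborsOff]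
      constructor
      · rintro ⟨h1, -, h2⟩
        obtain ⟨hzS, -, hza, -⟩ := hRU z h2
        exact ⟨hza, hneS z hzS, h1⟩
      · rintro ⟨hza, hzw, h1⟩
        refine ⟨h1, hu, hRclosed u hu z ⟨hS u huS (by simp [hzw, h1]), ?_, hza, ?_⟩ h1⟩
        · rintro rfl
          rcases hNv u (hneS u huS) h1.symm with h | h
          · exact hua h
          · exact hub h
        · rintro rfl
          exact hno u hu h1.symm
    have hodd : Odd (K.degree a') := by
      rw [← SimpleGraph.card_neighborFinset_eq_degree, hKN a' ha'R, card_erase_of_mem, hS2 a' ha'S]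
      · norm_num
      · simpa [ha.1] using ha'mem.2.symm
    obtain ⟨u, hua', hu⟩ := K.exists_ne_odd_degree_of_exists_odd_degree a' hodd
    by_cases huR : u ∈ R
    · obtain ⟨huS, huv, hua, hub⟩ := hRU u huR
      rw [← SimpleGraph.card_neighborFinset_eq_degree, hKN u huR, erase_eq_of_notMem, hS2 u huS]
        at hu
      · exact absurd hu (by decide)
      · intro h
        rw [mem_neighborsOff] at h
        rcases hNa u (hneS u huS) h.2.symm with h | h
        · exact huv h
        · exact hua' h
    · have h0 : K.neighborFinset u = ∅ := by
        ext z
        simp only [SimpleGraph.mem_neighborFinset, notMem_empty, iff_false]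
        exact fun h => huR h.2.1
      rw [← SimpleGraph.card_neighborFinset_eq_degree, h0] at hu
      simp at hu
  obtain ⟨b', hb'R, hb'⟩ := hRb
  have hnotR : v ∉ R ∧ a ∉ R ∧ b ∉ R ∧ w ∉ R :=
    ⟨fun h => (hRU _ h).2.1 rfl, fun h => (hRU _ h).2.2.1 rfl, fun h => (hRU _ h).2.2.2 rfl,
      fun h => hwS (hRU _ h).1⟩
  refine hG (isMinor_completeBipartiteGraph_two_three (X := {a}) (Y := {b})
    (M := ![{v}, {w}, R]) (connected_induce_singleton a) (connected_induce_singleton b)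
    ?_ ?_ ?_ ?_ ?_ ?_ ?_)
  · intro i
    fin_cases i
    · exact connected_induce_singleton v
    · exact connected_induce_singleton w
    · exact hRcon
  · simpa using hab
  · intro i
    fin_cases i
    · simpa using ha.2.ne'
    · simpa using ha.1
    · simpa using hnotR.2.1
  · intro i
    fin_cases i
    · simpa using hb.2.ne'
    · simpa using hb.1
    · simpa using hnotR.2.2.1
  · intro i j hij
    fin_cases i <;> fin_cases j
    · exact absurd rfl hij
    · simpa using hvw
    · simpa using hnotR.1
    · simpa using hvw.symm
    · exact absurd rfl hij
    · simpa using hnotR.2.2.2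
    · simpa using hnotR.1
    · simpa using hnotR.2.2.2
    · exact absurd rfl hij
  · intro i
    fin_cases i
    · simpa using ha.2.symm
    · simpa using (hw a ha.1).symm
    · exact ⟨a, rfl, a', ha'R, ha'mem.2⟩
  · intro i
    fin_cases i
    · simpa using hb.2.symm
    · simpa using (hw b hb.1).symm
    · exact ⟨b, rfl, b', hb'R, hb'⟩

/-- A `2`-regular graph in which adjacency is transitive consists of triangles, and the triangles
and their vertices can be numbered. -/
theorem exists_equiv_fin_prod_three {W : Type*} [Fintype W] (r : W → W → Prop)
    [DecidableRel r] (hsymm : ∀ u v, r u v → r v u) (hirr : ∀ u, ¬ r u u)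
    (htrans : ∀ u v z, r u v → r v z → u ≠ z → r u z)
    (hcard : ∀ u, #{v | r u v} = 2) :
    ∃ k, Fintype.card W = 3 * k ∧
      ∃ e : W ≃ Fin k × Fin 3, ∀ u v, r u v ↔ (e u).1 = (e v).1 ∧ (e u).2 ≠ (e v).2 := by
  classical
  let st : Setoid W :=
    { r := fun u v => u = v ∨ r u v
      iseqv :=
        { refl := fun u => Or.inl rfl
          symm := by
            rintro u v (h | h)
            · exact Or.inl h.symm
            · exact Or.inr (hsymm _ _ h)
          trans := by
            rintro u v z (rfl | h) (rfl | h')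
            · exact Or.inl rfl
            · exact Or.inr h'
            · exact Or.inr h
            · by_cases huz : u = z
              · exact Or.inl huz
              · exact Or.inr (htrans _ _ _ h h' huz) } }
  have hq : ∀ u v : W, Quotient.mk st u = Quotient.mk st v ↔ u = v ∨ r u v := fun u v =>
    Quotient.eq
  have hfib : ∀ q : Quotient st, Fintype.card {u // Quotient.mk st u = q} = 3 := by
    intro q
    induction q using Quotient.inductionOn with
    | h v =>
      rw [Fintype.card_subtype]
      have : univ.filter (fun u => Quotient.mk st u = Quotient.mk st v) =
          insert v (univ.filter (r v)) := by
        ext u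
        simp only [mem_filter, mem_univ, true_and, mem_insert, hq]
        exact ⟨Or.imp_right (hsymm _ _), Or.imp_right (hsymm _ _)⟩
      rw [this, card_insert_of_notMem (by simpa using hirr v), hcard]
  let e1 : W ≃ Quotient st × Fin 3 :=
    ((Equiv.sigmaFiberEquiv (Quotient.mk st)).symm.trans
      (Equiv.sigmaCongrRight fun q => Fintype.equivFinOfCardEq (hfib q))).trans
      (Equiv.sigmaEquivProd _ _)
  have he1 : ∀ u, (e1 u).1 = Quotient.mk st u := fun u => rfl
  let e : W ≃ Fin (Fintype.card (Quotient st)) × Fin 3 :=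
    e1.trans (Equiv.prodCongr (Fintype.equivFin _) (Equiv.refl _))
  have he : ∀ u v, (e u).1 = (e v).1 ↔ u = v ∨ r u v := by
    intro u v
    rw [← hq, ← he1, ← he1]
    exact (Fintype.equivFin (Quotient st)).injective.eq_iff
  refine ⟨Fintype.card (Quotient st), ?_, e, fun u v => ⟨fun h => ⟨(he u v).2 (Or.inr h), ?_⟩, ?_⟩⟩
  · rw [Fintype.card_congr e, Fintype.card_prod, Fintype.card_fin, Fintype.card_fin, mul_comm]
  · intro h2
    have : u = v := e.injective (Prod.ext ((he u v).2 (Or.inr h)) h2)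
    exact hirr v (this ▸ h)
  · rintro ⟨h1, h2⟩
    rcases (he u v).1 h1 with rfl | h
    · exact absurd rfl h2
    · exact h

/-- If `w` is dominating and `G - w` consists of a clique `K` on at most two vertices and a
`2`-regular graph, then `G` is the extremal graph. -/
theorem nonempty_iso_extremalGraph (hG : ¬ IsMinor (completeBipartiteGraph (Fin 2) (Fin 3)) G)
    (hw : ∀ v, v ≠ w → G.Adj w v) {K : Finset V} (hwK : w ∉ K) (hKcard : #K < 3)
    (hKclique : ∀ u ∈ K, ∀ v ∈ K, u ≠ v → G.Adj u v) (hKclosed : ∀ u ∈ K, neighborsOff G w u ⊆ K)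
    (h2 : ∀ u, u ≠ w → u ∉ K → #(neighborsOff G w u) = 2) :
    Nonempty (G ≃g extremalGraph 3 (Fintype.card V)) := by
  set S : Finset V := univ \ insert w K with hSdef
  have hmem : ∀ u, u ∈ S ↔ u ≠ w ∧ u ∉ K := fun u => by simp [hSdef]
  have hwS : w ∉ S := fun h => ((hmem w).1 h).1 rfl
  have hSclosed : ∀ u ∈ S, neighborsOff G w u ⊆ S := by
    intro u hu z hz
    rw [hmem] at hu ⊢
    rw [mem_neighborsOff] at hz
    exact ⟨hz.1, fun hzK => hu.2 (hKclosed z hzK (by simp [hu.1, hz.2.symm]))⟩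
  have hS2 : ∀ u ∈ S, #(neighborsOff G w u) = 2 := fun u hu =>
    h2 u ((hmem u).1 hu).1 ((hmem u).1 hu).2
  have hScard : Fintype.card V = #S + #K + 1 := by
    have := card_sdiff_add_card_eq_card (subset_univ (insert w K))
    rw [card_insert_of_notMem hwK, card_univ, ← hSdef] at this
    omega
  obtain ⟨k, hk, e, he⟩ := exists_equiv_fin_prod_three (W := S) (fun u v => G.Adj u v)
    (fun u v h => h.symm) (fun u => G.irrefl) (fun u v z huv hvz huz => by
      have hu := ((hmem u).1 u.2).1
      have hz := ((hmem z).1 z.2).1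
      exact adj_of_mem_neighborsOff hG hw hwS hSclosed hS2 v.2
        (by simp [hu, huv.symm]) (by simp [hz, hvz]) (fun h => huz (Subtype.ext h)))
    (fun u => by
      rw [← hS2 u u.2, ← card_map (Function.Embedding.subtype _)]
      congr 1
      ext z
      simp only [mem_map, mem_filter, mem_univ, true_and, Function.Embedding.subtype_apply,
        Subtype.exists, exists_and_left, exists_prop, mem_neighborsOff]
      constructor
      · rintro ⟨y, h1, h2, rfl⟩
        exact ⟨((hmem y).1 h2).1, h1⟩
      · rintro ⟨h1, h2⟩
        exact ⟨z, h2, hSclosed u u.2 (by simp [h1, h2]), rfl⟩)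
  rw [Fintype.card_coe] at hk
  obtain rfl : k = (Fintype.card V - 1) / 3 := by omega
  have hK' : #K = (Fintype.card V - 1) % 3 := by omega
  let eK : K ≃ Fin ((Fintype.card V - 1) % 3) := Fintype.equivFinOfCardEq (by simpa using hK')
  let f : Fin 1 ⊕ (Fin ((Fintype.card V - 1) / 3) × Fin 3 ⊕ Fin ((Fintype.card V - 1) % 3)) → V :=
    Sum.elim (fun _ => w) (Sum.elim (fun z => e.symm z) (fun i => eK.symm i))
  have hSprop : ∀ z, (e.symm z : V) ≠ w ∧ (e.symm z : V) ∉ K := fun z => (hmem _).1 (e.symm z).2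
  have hKprop : ∀ i, (eK.symm i : V) ≠ w := fun i h => hwK (h ▸ (eK.symm i).2)
  have hSK : ∀ z i, ¬ G.Adj (eK.symm i) (e.symm z) := fun z i h =>
    (hSprop z).2 (hKclosed _ (eK.symm i).2 (by simpa [(hSprop z).1] using h))
  have hinj : Function.Injective f := by
    rintro (u | z | i) (v | z' | i') h
    · rw [Subsingleton.elim u v]
    · exact absurd h.symm (hSprop z').1
    · exact absurd h.symm (hKprop i')
    · exact absurd h (hSprop z).1
    · have : z = z' := e.symm.injective (Subtype.ext h)
      rw [this]
    · exact absurd (eK.symm i').2 (fun h' => (hSprop z).2 (by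
        have h'' : (e.symm z : V) = eK.symm i' := h
        rwa [h'']))
    · exact absurd h (hKprop i)
    · exact absurd (eK.symm i).2 (fun h' => (hSprop z').2 (by
        have h'' : (eK.symm i : V) = e.symm z' := h
        rwa [← h'']))
    · have : i = i' := eK.symm.injective (Subtype.ext h)
      rw [this]
  have hbij : Function.Bijective f := by
    refine (Fintype.bijective_iff_injective_and_card f).2 ⟨hinj, ?_⟩
    simp only [Fintype.card_sum, Fintype.card_prod, Fintype.card_fin]
    omega
  refine ⟨(⟨Equiv.ofBijective f hbij, ?_⟩ : extremalGraph 3 (Fintype.card V) ≃g G).symm⟩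
  intro u v
  rw [Equiv.ofBijective_apply, Equiv.ofBijective_apply]
  rcases u with u | z | i <;> rcases v with v | z' | i'
  · exact iff_of_false G.irrefl (extremalGraph_adj_inl_inl 3 u v)
  · exact iff_of_true (hw _ (hSprop z').1) (extremalGraph_adj_inl_inr 3 u _)
  · exact iff_of_true (hw _ (hKprop i')) (extremalGraph_adj_inl_inr 3 u _)
  · exact iff_of_true (hw _ (hSprop z).1).symm (extremalGraph_adj_inr_inl 3 v _)
  · obtain ⟨j, c⟩ := z
    obtain ⟨j', c'⟩ := z'
    rw [extremalGraph_adj_block_block]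
    have h := he (e.symm (j, c)) (e.symm (j', c'))
    rwa [e.apply_symm_apply, e.apply_symm_apply] at h
  · exact iff_of_false (fun h => hSK z i' h.symm) (extremalGraph_adj_block_rest 3 z i')
  · exact iff_of_true (hw _ (hKprop i)).symm (extremalGraph_adj_inr_inl 3 v _)
  · exact iff_of_false (hSK z' i) (extremalGraph_adj_rest_block 3 z' i)
  · rw [extremalGraph_adj_rest_rest]
    constructor
    · rintro h rfl
      exact G.irrefl h
    · intro h
      exact hKclique _ (eK.symm i).2 _ (eK.symm i').2 fun h' =>
        h (eK.symm.injective (Subtype.ext h'))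

/-- A graph with a dominating vertex `w` and an eigenvalue `μ` that satisfies the bound of
`le_of_specRadius_extremalGraph_le` is extremal. The sum of `(2 - deg v) * x v` over the vertices
`v` of `G - w`, with `deg` the degree in `G - w`, is at most `2 / (μ - 1)`, while every entry `x v`
is at least `1 / μ`. So the degrees fall short of two by at most two in total, and if this happens
at two nonadjacent vertices, their entries are too large. -/
theorem nonempty_iso_of_dominating
    (hG : ¬ IsMinor (completeBipartiteGraph (Fin 2) (Fin 3)) G)
    (hw : ∀ v, v ≠ w → G.Adj w v) {x : V → ℝ} {μ : ℝ} (hμ : 200 ≤ μ) (hx0 : ∀ v, 0 ≤ x v)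
    (hxw : x w = 1) (hev : ∀ v, ∑ u ∈ G.neighborFinset v, x u = μ * x v)
    (hn : (Fintype.card V : ℝ) - 1 - 2 / (μ - 1) ≤ μ ^ 2 - 2 * μ) :
    Nonempty (G ≃g extremalGraph 3 (Fintype.card V)) := by
  have hμ0 : 0 < μ := by linarith
  have hNw : G.neighborFinset w = univ.erase w := by
    ext u
    simp only [SimpleGraph.mem_neighborFinset, mem_erase, mem_univ, and_true]
    exact ⟨fun h => h.ne', hw u⟩
  have hwN : ∀ v, v ≠ w → w ∈ G.neighborFinset v := fun v hv => by simpa using (hw v hv).symm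
  have hev' : ∀ v, v ≠ w → μ * x v = 1 + ∑ u ∈ neighborsOff G w v, x u := fun v hv => by
    rw [← hev, ← add_sum_erase _ _ (hwN v hv), hxw]
    rfl
  have hlow : ∀ v, v ≠ w → 1 / μ ≤ x v := fun v hv => by
    rw [div_le_iff₀ hμ0, mul_comm, hev' v hv]
    linarith [sum_nonneg fun u (_ : u ∈ neighborsOff G w v) => hx0 u]
  have hsumx : ∑ v ∈ univ.erase w, x v = μ := by
    have := hev w
    rwa [hNw, hxw, mul_one] at this
  have hle2 : ∀ v, v ≠ w → #(neighborsOff G w v) ≤ 2 := fun v hv =>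
    card_neighborsOff_le_two hG hw hv
  set t : V → ℕ := fun v => 2 - #(neighborsOff G w v) with ht
  have htc : ∀ v, v ≠ w → (t v : ℝ) = 2 - #(neighborsOff G w v) := fun v hv => by
    simp only [ht, Nat.cast_sub (hle2 v hv), Nat.cast_ofNat]
  have hcard1 : 1 ≤ Fintype.card V := Fintype.card_pos_iff.2 ⟨w⟩
  -- the eigenvalue equations, summed over all `v ≠ w`
  have hdef : ∑ v ∈ univ.erase w, (t v : ℝ) * x v ≤ 2 / (μ - 1) := by
    have h1 : ∑ v ∈ univ.erase w, ∑ u ∈ neighborsOff G w v, x u =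
        ∑ u ∈ univ.erase w, (#(neighborsOff G w u) : ℝ) * x u := by
      rw [sum_comm' (t' := univ.erase w) (s' := fun u => neighborsOff G w u)]
      · simp
      · intro v u
        simp only [mem_erase, mem_univ, mem_neighborsOff, and_true, G.adj_comm u v]
        tauto
    have h2 : ∑ v ∈ univ.erase w, (t v : ℝ) * x v =
        2 * μ - ∑ u ∈ univ.erase w, (#(neighborsOff G w u) : ℝ) * x u := by
      rw [← hsumx, mul_sum, ← sum_sub_distrib]
      refine sum_congr rfl fun v hv => ?_
      rw [htc v (ne_of_mem_erase hv)]
      ring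
    have h3 : μ * μ = (Fintype.card V - 1) +
        ∑ v ∈ univ.erase w, ∑ u ∈ neighborsOff G w v, x u := by
      calc μ * μ = μ * ∑ v ∈ univ.erase w, x v := by rw [hsumx]
        _ = ∑ v ∈ univ.erase w, (1 + ∑ u ∈ neighborsOff G w v, x u) := by
          rw [mul_sum]
          exact sum_congr rfl fun v hv => hev' v (ne_of_mem_erase hv)
        _ = _ := by
          rw [sum_add_distrib]
          simp [Nat.cast_sub hcard1]
    rw [h2, ← h1]
    linarith
  have heven : Even (∑ v ∈ univ.erase w, t v) := by
    have h1 : ∑ v ∈ univ.erase w, t v + ∑ v, G.degree v = 4 * (Fintype.card V - 1) := by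
      have hd : ∀ v ∈ univ.erase w, t v + G.degree v = 3 := fun v hv => by
        have hv' := ne_of_mem_erase hv
        have h3 := hle2 v hv'
        have h4 : #(neighborsOff G w v) + 1 = G.degree v := by
          rw [neighborsOff, card_erase_add_one (hwN v hv'),
            SimpleGraph.card_neighborFinset_eq_degree]
        simp only [ht]
        omega
      rw [← add_sum_erase _ _ (mem_univ w), add_left_comm, ← sum_add_distrib, sum_congr rfl hd,
        ← SimpleGraph.card_neighborFinset_eq_degree, hNw]
      simp
      ring
    rw [G.sum_degrees_eq_twice_card_edges] at h1
    exact ⟨2 * (Fintype.card V - 1) - #G.edgeFinset, by omega⟩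
  have hlt : ∑ v ∈ univ.erase w, t v < 3 := by
    have h1 : (∑ v ∈ univ.erase w, (t v : ℝ)) * (1 / μ) ≤ 2 / (μ - 1) := by
      refine le_trans ?_ hdef
      rw [sum_mul]
      exact sum_le_sum fun v hv => mul_le_mul_of_nonneg_left (hlow v (ne_of_mem_erase hv))
        (Nat.cast_nonneg _)
    by_contra! h3
    have h4 : (3 : ℝ) ≤ ∑ v ∈ univ.erase w, (t v : ℝ) := by exact_mod_cast h3
    have h5 : 3 * (1 / μ) ≤ 2 / (μ - 1) :=
      (mul_le_mul_of_nonneg_right h4 (by positivity)).trans h1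
    rw [mul_one_div, div_le_div_iff₀ hμ0 (by linarith)] at h5
    linarith
  have hdeg : ∀ v, v ≠ w → t v = 0 → #(neighborsOff G w v) = 2 := fun v hv h => by
    have := hle2 v hv
    simp only [ht] at h
    omega
  by_cases hzero : ∀ v, v ≠ w → t v = 0
  · exact nonempty_iso_extremalGraph hG hw (K := ∅) (by simp) (by simp) (by simp) (by simp)
      fun u hu _ => hdeg u hu (hzero u hu)
  push Not at hzero
  obtain ⟨a, haw, hta⟩ := hzero
  have ha : a ∈ univ.erase w := by simp [haw]
  have hsuma := add_sum_erase _ t ha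
  have htwo : ∑ v ∈ univ.erase w, t v = 2 := by
    obtain ⟨r, hr⟩ := heven
    omega
  by_cases hrest : ∀ v ∈ (univ.erase w).erase a, t v = 0
  · -- a single vertex of degree zero
    have hta2 : t a = 2 := by
      rw [sum_eq_zero hrest] at hsuma
      omega
    refine nonempty_iso_extremalGraph hG hw (K := {a}) (by simpa using haw.symm) (by simp) ?_ ?_ ?_
    · intro u hu v hv huv
      rw [mem_singleton] at hu hv
      exact absurd (hu.trans hv.symm) huv
    · intro u hu
      rw [mem_singleton] at hu
      have h0 : #(neighborsOff G w u) = 0 := by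
        rw [hu]
        simp only [ht] at hta2
        omega
      rw [card_eq_zero.1 h0]
      exact empty_subset _
    · intro u hu hua
      exact hdeg u hu (hrest u (by simpa [hu] using hua))
  -- two vertices of degree one
  push Not at hrest
  obtain ⟨b, hb, htb⟩ := hrest
  have hsumb := add_sum_erase _ t hb
  have hba : b ≠ a := ne_of_mem_erase hb
  have hbw : b ≠ w := ne_of_mem_erase (mem_of_mem_erase hb)
  have hta1 : t a = 1 := by omega
  have htb1 : t b = 1 := by omega
  have hothers : ∀ u, u ≠ w → u ≠ a → u ≠ b → #(neighborsOff G w u) = 2 := by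
    intro u huw hua hub
    refine hdeg u huw ?_
    have h0 : ∑ v ∈ ((univ.erase w).erase a).erase b, t v = 0 := by omega
    exact (sum_eq_zero_iff.1 h0) u (by simp [huw, hua, hub])
  have hda : #(neighborsOff G w a) = 1 := by
    simp only [ht] at hta1
    omega
  have hdb : #(neighborsOff G w b) = 1 := by
    simp only [ht] at htb1
    omega
  by_cases hadj : G.Adj a b
  · refine nonempty_iso_extremalGraph hG hw (K := {a, b}) ?_ ?_ ?_ ?_ ?_
    · simp [haw.symm, hbw.symm]
    · rw [card_pair hba.symm]
      norm_num
    · intro u hu v hv huv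
      simp only [mem_insert, mem_singleton] at hu hv
      rcases hu with rfl | rfl <;> rcases hv with rfl | rfl
      · exact absurd rfl huv
      · exact hadj
      · exact hadj.symm
      · exact absurd rfl huv
    · intro u hu z hz
      simp only [mem_insert, mem_singleton] at hu ⊢
      rcases hu with rfl | rfl
      · exact Or.inr (card_le_one.1 hda.le z hz b (by simp [hbw, hadj]))
      · exact Or.inl (card_le_one.1 hdb.le z hz a (by simp [haw, hadj.symm]))
    · intro u huw hu
      simp only [mem_insert, mem_singleton, not_or] at hu
      exact hothers u huw hu.1 hu.2
  · exfalso
    -- the unique neighbour of `c` has degree two, which forces a large entry at `c`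
    have hlarge : ∀ c, c ≠ w → #(neighborsOff G w c) = 1 →
        (∀ z ∈ neighborsOff G w c, #(neighborsOff G w z) = 2) →
        1 + (1 + 2 * (1 / μ)) * (1 / μ) ≤ μ * x c := by
      intro c hc hc1 hc2
      obtain ⟨z, hz⟩ := card_eq_one.1 hc1
      have hzmem : z ∈ neighborsOff G w c := by simp [hz]
      have hzw := (mem_neighborsOff.1 hzmem).1
      rw [hev' c hc, hz, sum_singleton, mul_one_div]
      gcongr
      rw [div_le_iff₀ hμ0, mul_comm (x z), hev' z hzw]
      gcongr
      have h := card_nsmul_le_sum (neighborsOff G w z) x (1 / μ) fun u hu =>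
        hlow u (mem_neighborsOff.1 hu).1
      rw [hc2 z hzmem] at h
      simpa using h
    have hxa := hlarge a haw hda fun z hz => by
      rw [mem_neighborsOff] at hz
      exact hothers z hz.1 hz.2.ne' fun h => hadj (h ▸ hz.2)
    have hxb := hlarge b hbw hdb fun z hz => by
      rw [mem_neighborsOff] at hz
      exact hothers z hz.1 (fun h => hadj (h ▸ hz.2).symm) hz.2.ne'
    have hab : x a + x b ≤ 2 / (μ - 1) := by
      refine le_trans ?_ hdef
      rw [← add_sum_erase _ _ ha, ← add_sum_erase _ _ hb, hta1, htb1, Nat.cast_one, one_mul,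
        one_mul, ← add_assoc]
      exact le_add_of_nonneg_right (sum_nonneg fun v _ => mul_nonneg (Nat.cast_nonneg _) (hx0 v))
    rw [le_div_iff₀ (by linarith)] at hab
    have hinv : 1 / μ * μ = 1 := by field_simp
    have hpos : 0 < 1 / μ := by positivity
    generalize 1 / μ = y at *
    -- multiplying `hxa + hxb` by `μ - 1` gives `2 * y * (1 - 2 * y) ≤ 0`
    have h1 := mul_le_mul_of_nonneg_right (add_le_add hxa hxb) (show 0 ≤ μ - 1 by linarith)
    have h2 : (μ * x a + μ * x b) * (μ - 1) ≤ 2 * μ := by nlinarith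
    have h3 : (1 + (1 + 2 * y) * y + (1 + (1 + 2 * y) * y)) * (μ - 1) =
        2 * μ - 2 + 2 * (y * μ) - 2 * y + 4 * y * (y * μ) - 4 * y ^ 2 := by ring
    rw [h3, hinv] at h1
    have hy : y < 1 / 2 := by nlinarith
    nlinarith

end Cone

end SpectralMinor

theorem theorem1 (n : ℕ) (hn : 40000 < n) :
    (¬ SpectralMinor.IsMinor (completeBipartiteGraph (Fin 2) (Fin 3))
        (SpectralMinor.extremalGraph 3 n)) ∧
      ∀ {V : Type*} [Fintype V] (G : SimpleGraph V), Fintype.card V = n →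
        ¬ SpectralMinor.IsMinor (completeBipartiteGraph (Fin 2) (Fin 3)) G →
        ¬ Nonempty (G ≃g SpectralMinor.extremalGraph 3 n) →
        SpectralMinor.specRadius G < SpectralMinor.specRadius (SpectralMinor.extremalGraph 3 n) := by
  classical
  refine ⟨SpectralMinor.not_isMinor_extremalGraph n, ?_⟩
  intro V _ G hcard hG hiso
  by_contra! hle
  have : Nonempty V := Fintype.card_pos_iff.1 (by omega)
  obtain ⟨-, y, hy0, hyne, hy⟩ := SpectralMinor.specRadius_spec G
  have hμ := (SpectralMinor.two_hundred_le_specRadius_extremalGraph hn).trans hle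
  have hbound := SpectralMinor.le_of_specRadius_extremalGraph_le (by omega) (by linarith) hle
  obtain ⟨w, hw⟩ := Finite.exists_max y
  have hyw : 0 < y w := by
    obtain ⟨v, hv⟩ := Function.ne_iff.1 hyne
    exact ((hy0 v).lt_of_ne (Ne.symm hv)).trans_le (hw v)
  -- rescale the eigenvector so that its largest entry is `1`
  have hx0 : ∀ v, 0 ≤ y v / y w := fun v => div_nonneg (hy0 v) hyw.le
  have hx1 : ∀ v, y v / y w ≤ 1 := fun v => (div_le_one hyw).2 (hw v)
  have hxw : y w / y w = 1 := div_self hyw.ne'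
  have hev : ∀ v, ∑ u ∈ G.neighborFinset v, y u / y w = SpectralMinor.specRadius G * (y v / y w) :=
    fun v => by rw [← Finset.sum_div, hy v, mul_div_assoc]
  subst hcard
  exact hiso (SpectralMinor.nonempty_iso_of_dominating hG
    (fun v hv => SpectralMinor.adj_of_isMax hG hμ hx0 hx1 hxw hev hbound hv) hμ hx0 hxw hev hbound)
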